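/- For every real number $a$ with $-\pi<a<\pi$ (in particular for $0<a<\pi$), the function $y\mapsto \ln\ln\!\left(\tfrac1y\right)\dfrac{\sin a}{1+2y\cos a+y^2}$ is Lebesgue integrable on $(0,1)$, and $$\int_0^1 \frac{\ln\ln\left(\frac1y\right)\,\sin a}{1+2y\cos a+y^2}\,dy=\frac{\pi}{2}\,\ln\!\left(\frac{(2\pi)^{a/\pi}\,\Gamma\!\left(\frac12+\frac{a}{2\pi}\right)}{\Gamma\!\left(\frac12-\frac{a}{2\pi}\right)}\right),$$ where $\Gamma$ is Euler's Gamma function and $\ln$ is the natural logarithm. -/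

import Mathlib

open Complex HurwitzZeta Set Filter Topology MeasureTheory

/-! Substituting `y = exp (-t)` turns the integral into `∫ log t * K t` over `t > 0`, which is `M'
1` for the Mellin transform `M` of `K = malmstenKernel a`. Expanding `K` in a sine series gives `M s
= -Γ(s) * sinZeta x s` with `x = 1/2 + a/(2π)`, and the functional equation converts this into
`hurwitzZetaOdd x (1 - s)` (`hurwitzZetaOdd_one_sub_eq_mellin`).

It remains to know the odd Hurwitz zeta function to first order at `0`: value `1/2 - x`, derivative
`log (Γ(x)/Γ(1-x)) / 2` (`deriv_hurwitzZetaOdd_zero`). Both come from a series that converges past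
`0` (`two_mul_hurwitzZetaOdd_eq`); its derivative at `0` is identified through Euler's limit for
`Γ`. -/

/-! ### Continuation of the odd Hurwitz zeta function to a neighbourhood of `0` -/

lemma norm_ofReal_cpow_neg_sub_one_sub_le {p y z : ℝ} (hp : 0 < p) (hy : p ≤ y) (hz : p ≤ z)
    {s : ℂ} (hs : -1 < s.re) :
    ‖(y : ℂ) ^ (-s - 1) - (z : ℂ) ^ (-s - 1)‖ ≤ ‖s + 1‖ * p ^ (-s.re - 2) * |y - z| := by
  have hs1 : -s - 1 ≠ 0 := fun h => by
    have := congrArg re h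
    simp at this; linarith
  have key := (convex_Ici p).norm_image_sub_le_of_norm_hasDerivWithin_le
    (f := fun w : ℝ => (w : ℂ) ^ (-s - 1)) (f' := fun w : ℝ => (-s - 1) * (w : ℂ) ^ (-s - 1 - 1))
    (C := ‖s + 1‖ * p ^ (-s.re - 2))
    (fun w hw => (hasDerivAt_ofReal_cpow_const (hp.trans_le hw).ne' hs1).hasDerivWithinAt)
    (fun w hw => ?_) hz hy
  · simpa [Real.norm_eq_abs] using key
  · have hw0 : 0 < w := hp.trans_le hw
    rw [norm_mul, norm_cpow_eq_rpow_re_of_pos hw0, show -s - 1 = -(s + 1) by ring, norm_neg]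
    refine mul_le_mul_of_nonneg_left ?_ (norm_nonneg _)
    have : (-(s + 1) - 1).re = -s.re - 2 := by simp; ring
    rw [this]
    exact Real.rpow_le_rpow_of_nonpos hp hw (by linarith)

/-- The general term of the series that continues twice the odd Hurwitz zeta function. -/
noncomputable def hurwitzOddTerm (x : ℝ) (m : ℕ) (s : ℂ) : ℂ :=
  ((m + 1 + x : ℝ) : ℂ) ^ (-s) - ((m + 2 - x : ℝ) : ℂ) ^ (-s)
    - (2 * x - 1) * (((m + 2 : ℝ) : ℂ) ^ (-s) - ((m + 1 : ℝ) : ℂ) ^ (-s))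

/-- The telescoping correction cancels the first-order part of the difference of the two main
powers, which gains a power of `m` and gives summability near `s = 0`. -/
lemma norm_hurwitzOddTerm_le {x : ℝ} (hx : x ∈ Ioo (0 : ℝ) 1) (m : ℕ) {s : ℂ} (hs : -1 < s.re) :
    ‖hurwitzOddTerm x m s‖ ≤ 2 * (‖s‖ * ‖s + 1‖ * ((m : ℝ) + 1) ^ (-s.re - 2)) := by
  obtain ⟨hx0, hx1⟩ := hx
  have hm : (0 : ℝ) ≤ m := m.cast_nonneg
  rcases eq_or_ne s 0 with rfl | hs0
  · simp [hurwitzOddTerm]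
  have hd (k q θ : ℝ) (h : 0 < k + q * θ) :
      HasDerivAt (fun θ : ℝ => ((k + q * θ : ℝ) : ℂ) ^ (-s))
        (q * (-s * ((k + q * θ : ℝ) : ℂ) ^ (-s - 1))) θ := by
    have h1 := hasDerivAt_ofReal_cpow_const h.ne' (neg_ne_zero.mpr hs0)
    have h2 : HasDerivAt (fun θ : ℝ => k + q * θ) q θ := by
      simpa using ((hasDerivAt_id θ).const_mul q).const_add k
    simpa [Function.comp_def] using h1.scomp θ h2
  -- All four bases are `c ± u` and `c ± 1/2`. Scaling the offsets by `θ` joins the term at `θ = 1`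
  -- to zero at `θ = 0`.
  set c : ℝ := m + 3 / 2 with hc
  set u : ℝ := x - 1 / 2 with hu
  have hpos {q θ : ℝ} (hq : |q| ≤ 1 / 2) (hθ : θ ∈ Icc (0 : ℝ) 1) : m + 1 ≤ c + q * θ := by
    have := abs_le.mp hq
    nlinarith [hθ.1, hθ.2]
  have hu1 : |u| ≤ 1 / 2 := abs_le.mpr ⟨by linarith, by linarith⟩
  have hu2 : |-u| ≤ 1 / 2 := by rwa [abs_neg]
  have hh1 : |(1 / 2 : ℝ)| ≤ 1 / 2 := by norm_num
  have hh2 : |(-(1 / 2) : ℝ)| ≤ 1 / 2 := by rw [abs_neg]; exact hh1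
  set D : ℝ → ℝ → ℂ := fun q θ => ((c + q * θ : ℝ) : ℂ) ^ (-s - 1)
  set B := ‖s + 1‖ * ((m : ℝ) + 1) ^ (-s.re - 2)
  have hD {q r θ : ℝ} (hq : |q| ≤ 1 / 2) (hr : |r| ≤ 1 / 2) (hθ : θ ∈ Icc (0 : ℝ) 1) :
      ‖D q θ - D r θ‖ ≤ B := by
    refine (norm_ofReal_cpow_neg_sub_one_sub_le (by linarith) (hpos hq hθ) (hpos hr hθ) hs).trans ?_
    refine mul_le_of_le_one_right (by positivity) ?_
    rw [show c + q * θ - (c + r * θ) = (q - r) * θ by ring, abs_mul, abs_of_nonneg hθ.1]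
    have := abs_sub q r
    nlinarith [hθ.1, hθ.2, abs_nonneg (q - r)]
  have key := norm_image_sub_le_of_norm_deriv_le_segment_01'
    (f := fun θ : ℝ => ((c + u * θ : ℝ) : ℂ) ^ (-s) - ((c + (-u) * θ : ℝ) : ℂ) ^ (-s)
      - (2 * x - 1) * (((c + (1 / 2 : ℝ) * θ : ℝ) : ℂ) ^ (-s)
        - ((c + (-(1 / 2) : ℝ) * θ : ℝ) : ℂ) ^ (-s)))
    (f' := fun θ => (u : ℂ) * (-s * D u θ) - ((-u : ℝ) : ℂ) * (-s * D (-u) θ)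
      - (2 * x - 1) * (((1 / 2 : ℝ) : ℂ) * (-s * D (1 / 2) θ)
        - ((-(1 / 2) : ℝ) : ℂ) * (-s * D (-(1 / 2)) θ)))
    (C := 2 * (‖s‖ * B))
    (fun θ hθ => (((hd _ _ _ ?_).sub (hd _ _ _ ?_)).sub
      (((hd _ _ _ ?_).sub (hd _ _ _ ?_)).const_mul _)).hasDerivWithinAt)
    (fun θ hθ => ?_)
  · have e1 : c + u * 1 = m + 1 + x := by simp only [hc, hu]; ring
    have e2 : c + -u * 1 = m + 2 - x := by simp only [hc, hu]; ring
    have e3 : c + (1 / 2) * 1 = m + 2 := by simp only [hc]; ring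
    have e4 : c + -(1 / 2) * 1 = m + 1 := by simp only [hc]; ring
    simp only [e1, e2, e3, e4] at key
    simpa [hurwitzOddTerm, B, mul_assoc] using key
  · linarith [hpos hu1 hθ]
  · linarith [hpos hu2 hθ]
  · linarith [hpos hh1 hθ]
  · linarith [hpos hh2 hθ]
  · have hθ' := Ico_subset_Icc_self hθ
    -- Since `2x - 1 = 2u`, the derivative regroups into differences of `D`, each at most `B`.
    have e : (u : ℂ) * (-s * D u θ) - ((-u : ℝ) : ℂ) * (-s * D (-u) θ)
      - (2 * x - 1) * (((1 / 2 : ℝ) : ℂ) * (-s * D (1 / 2) θ)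
        - ((-(1 / 2) : ℝ) : ℂ) * (-s * D (-(1 / 2)) θ))
        = (u : ℂ) * (-s * ((D u θ - D (1 / 2) θ) + (D (-u) θ - D (-(1 / 2)) θ))) := by
      have : (2 * x - 1 : ℂ) = 2 * u := by simp only [hu]; push_cast; ring
      rw [this]; push_cast; ring
    rw [e, norm_mul, norm_mul, norm_neg, norm_real, Real.norm_eq_abs]
    have h1 := (norm_add_le _ _).trans (add_le_add (hD hu1 hh1 hθ') (hD hu2 hh2 hθ'))
    have hB : 0 ≤ B := (norm_nonneg _).trans (hD hu1 hh1 hθ')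
    calc |u| * (‖s‖ * _) ≤ 1 * (‖s‖ * (B + B)) := by gcongr; linarith
      _ = _ := by ring

lemma hasDerivAt_ofReal_cpow_neg {y : ℝ} (hy : 0 < y) (s : ℂ) :
    HasDerivAt (fun s : ℂ => (y : ℂ) ^ (-s)) (-((y : ℂ) ^ (-s) * Real.log y)) s := by
  have := (hasDerivAt_neg s).const_cpow (c := (y : ℂ)) (Or.inl (ofReal_ne_zero.mpr hy.ne'))
  simpa [ofReal_log hy.le] using this

lemma hasDerivAt_hurwitzOddTerm {x : ℝ} (hx : x ∈ Ioo (0 : ℝ) 1) (m : ℕ) (s : ℂ) :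
    HasDerivAt (hurwitzOddTerm x m)
      (-(((m + 1 + x : ℝ) : ℂ) ^ (-s) * Real.log (m + 1 + x))
        - -(((m + 2 - x : ℝ) : ℂ) ^ (-s) * Real.log (m + 2 - x))
        - (2 * x - 1) * (-(((m + 2 : ℝ) : ℂ) ^ (-s) * Real.log (m + 2))
          - -(((m + 1 : ℝ) : ℂ) ^ (-s) * Real.log (m + 1)))) s := by
  obtain ⟨hx0, hx1⟩ := hx
  have hm : (0 : ℝ) ≤ m := m.cast_nonneg
  exact ((hasDerivAt_ofReal_cpow_neg (by linarith) s).sub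
    (hasDerivAt_ofReal_cpow_neg (by linarith) s)).sub
    (((hasDerivAt_ofReal_cpow_neg (by linarith) s).sub
    (hasDerivAt_ofReal_cpow_neg (by linarith) s)).const_mul _)

lemma hasSum_hurwitzOddTerm {x : ℝ} (hx : x ∈ Ioo (0 : ℝ) 1) {s : ℂ} (hs : 1 < s.re) :
    HasSum (fun m => hurwitzOddTerm x m s)
      (2 * hurwitzZetaOdd x s - ((x : ℂ) ^ (-s) - ((1 - x : ℝ) : ℂ) ^ (-s)) + (2 * x - 1)) := by
  have h1 := (hasSum_nat_hurwitzZetaOdd_of_mem_Icc (Ioo_subset_Icc_self hx) hs).mul_left 2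
  have h2 := (hasSum_nat_add_iff' 1).mpr h1
  have h3 : Summable fun m : ℕ => ((m + 1 : ℝ) : ℂ) ^ (-s) := by
    have := (summable_nat_add_iff 1).mpr (Complex.summable_one_div_nat_cpow.mpr hs)
    refine this.congr fun m => ?_
    push_cast
    rw [cpow_neg, one_div]
  have h4 := (((hasSum_nat_add_iff' 1).mpr h3.hasSum).sub h3.hasSum).mul_left (2 * (x : ℂ) - 1)
  convert! h2.sub h4 using 1
  · ext m
    rw [hurwitzOddTerm]
    simp only [one_div, ← cpow_neg]
    push_cast
    rw [show (m : ℂ) + 1 + 1 = m + 2 by ring]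
    ring
  · simp [cpow_neg]
    ring

/-- A convex neighbourhood of `0` reaching into the half-plane `1 < re s`. -/
def hurwitzOddRegion : Set ℂ := {s | -1 / 2 < s.re} ∩ Metric.ball 0 4

lemma isOpen_hurwitzOddRegion : IsOpen hurwitzOddRegion :=
  (isOpen_lt continuous_const continuous_re).inter Metric.isOpen_ball

lemma isPreconnected_hurwitzOddRegion : IsPreconnected hurwitzOddRegion :=
  ((convex_halfSpace_re_gt _).inter (convex_ball _ _)).isPreconnected

lemma zero_mem_hurwitzOddRegion : (0 : ℂ) ∈ hurwitzOddRegion := by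
  constructor
  · norm_num
  · simp

lemma norm_hurwitzOddTerm_le_of_mem {x : ℝ} (hx : x ∈ Ioo (0 : ℝ) 1) (m : ℕ) {s : ℂ}
    (hs : s ∈ hurwitzOddRegion) :
    ‖hurwitzOddTerm x m s‖ ≤ 40 * ((m : ℝ) + 1) ^ (-3 / 2 : ℝ) := by
  obtain ⟨h1, h2⟩ := hs
  simp only [mem_ofPred_eq, Metric.mem_ball, dist_zero_right] at h1 h2
  refine (norm_hurwitzOddTerm_le hx m (by linarith)).trans ?_
  have h3 : ‖s + 1‖ ≤ 5 := (norm_add_le _ _).trans (by rw [norm_one]; linarith)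
  have hm : (1 : ℝ) ≤ m + 1 := by linarith [m.cast_nonneg (α := ℝ)]
  have h4 : ((m : ℝ) + 1) ^ (-s.re - 2) ≤ ((m : ℝ) + 1) ^ (-3 / 2 : ℝ) :=
    Real.rpow_le_rpow_of_exponent_le hm (by linarith)
  calc _ ≤ 2 * (4 * 5 * ((m : ℝ) + 1) ^ (-3 / 2 : ℝ)) := by gcongr
    _ = _ := by ring

lemma summable_hurwitzOddTerm_bound : Summable fun m : ℕ => 40 * ((m : ℝ) + 1) ^ (-3 / 2 : ℝ) := by
  have := (summable_nat_add_iff 1).mpr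
    (Real.summable_nat_rpow.mpr (show (-3 / 2 : ℝ) < -1 by norm_num))
  exact (this.congr fun m => by push_cast; rfl).mul_left 40

/-- Identity theorem: both sides are analytic on the region and agree near `2`, where the Dirichlet
series converges absolutely. -/
lemma two_mul_hurwitzZetaOdd_eq {x : ℝ} (hx : x ∈ Ioo (0 : ℝ) 1) {s : ℂ}
    (hs : s ∈ hurwitzOddRegion) :
    2 * hurwitzZetaOdd x s = (x : ℂ) ^ (-s) - ((1 - x : ℝ) : ℂ) ^ (-s)
      + ∑' m, hurwitzOddTerm x m s - (2 * x - 1) := by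
  have hf : AnalyticOnNhd ℂ (fun s => 2 * hurwitzZetaOdd x s) hurwitzOddRegion :=
    ((differentiable_hurwitzZetaOdd x).const_mul 2).differentiableOn.analyticOnNhd
      isOpen_hurwitzOddRegion
  have hg : AnalyticOnNhd ℂ (fun s => (x : ℂ) ^ (-s) - ((1 - x : ℝ) : ℂ) ^ (-s)
      + ∑' m, hurwitzOddTerm x m s - (2 * x - 1)) hurwitzOddRegion := by
    refine DifferentiableOn.analyticOnNhd ?_ isOpen_hurwitzOddRegion
    refine (DifferentiableOn.add ?_ ?_).sub_const _
    · exact fun s _ => ((hasDerivAt_ofReal_cpow_neg hx.1 s).sub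
        (hasDerivAt_ofReal_cpow_neg (sub_pos.mpr hx.2) s)).differentiableAt.differentiableWithinAt
    · exact differentiableOn_tsum_of_summable_norm summable_hurwitzOddTerm_bound
        (fun m s _ => (hasDerivAt_hurwitzOddTerm hx m s).differentiableAt.differentiableWithinAt)
        isOpen_hurwitzOddRegion (fun m s hs => norm_hurwitzOddTerm_le_of_mem hx m hs)
  refine hf.eqOn_of_preconnected_of_eventuallyEq hg isPreconnected_hurwitzOddRegion
    (z₀ := 2) ⟨by norm_num, by norm_num⟩ ?_ hs
  filter_upwards [(isOpen_lt continuous_const continuous_re).mem_nhds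
    (show (1 : ℝ) < (2 : ℂ).re by simp)] with w hw
  simp only [(hasSum_hurwitzOddTerm hx hw).tsum_eq]
  ring

lemma hurwitzZetaOdd_zero_of_mem_Ioo {x : ℝ} (hx : x ∈ Ioo (0 : ℝ) 1) :
    hurwitzZetaOdd x 0 = 1 / 2 - x := by
  have := two_mul_hurwitzZetaOdd_eq hx zero_mem_hurwitzOddRegion
  simp [hurwitzOddTerm] at this
  linear_combination this / 2

/-! ### Derivative at `0` and the Gamma function -/

lemma sum_range_log_sub_log (x : ℝ) (N : ℕ) :
    -Real.log x + Real.log (1 - x) + ∑ m ∈ Finset.range N,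
      (-Real.log (m + 1 + x) + Real.log (m + 2 - x)
        + (2 * x - 1) * (Real.log (m + 2) - Real.log (m + 1)))
    = (2 * x - 1) * Real.log (N + 1)
      + ∑ j ∈ Finset.range (N + 1), (Real.log (1 - x + j) - Real.log (x + j)) := by
  induction N with
  | zero => simp; ring
  | succ N ih =>
    rw [Finset.sum_range_succ, ← add_assoc, ih, Finset.sum_range_succ _ (N + 1)]
    push_cast
    rw [show (N : ℝ) + 2 - x = 1 - x + (N + 1) by ring, show (N : ℝ) + 1 + x = x + (N + 1) by ring,
      show (N : ℝ) + 1 + 1 = N + 2 by ring]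
    ring

lemma log_GammaSeq_div {x : ℝ} (hx : x ∈ Ioo (0 : ℝ) 1) {N : ℕ} (hN : 0 < N) :
    Real.log (Real.GammaSeq x N / Real.GammaSeq (1 - x) N) = (2 * x - 1) * Real.log N
      + ∑ j ∈ Finset.range (N + 1), (Real.log (1 - x + j) - Real.log (x + j)) := by
  have hx0 := hx.1
  have hx1 : 0 < 1 - x := sub_pos.mpr hx.2
  have hN' : (0 : ℝ) < N := Nat.cast_pos.mpr hN
  have hlog {y : ℝ} (hy : 0 < y) : 0 < Real.GammaSeq y N ∧ Real.log (Real.GammaSeq y N) =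
      y * Real.log N + Real.log N.factorial
        - ∑ j ∈ Finset.range (N + 1), Real.log (y + j) := by
    have hj (j : ℕ) : 0 < y + j := by positivity
    have hprod : 0 < ∏ j ∈ Finset.range (N + 1), (y + (j : ℝ)) := Finset.prod_pos fun j _ => hj j
    have hfac : (0 : ℝ) < N.factorial := Nat.cast_pos.mpr N.factorial_pos
    refine ⟨by rw [Real.GammaSeq]; positivity, ?_⟩
    rw [Real.GammaSeq, Real.log_div (by positivity) hprod.ne',
      Real.log_mul (by positivity) hfac.ne', Real.log_rpow hN', Real.log_prod fun j _ => (hj j).ne']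
  rw [Real.log_div (hlog hx0).1.ne' (hlog hx1).1.ne', (hlog hx0).2, (hlog hx1).2,
    Finset.sum_sub_distrib]
  ring

/-- Termwise differentiation at `0` gives logarithms whose partial sums are those of `GammaSeq x N /
GammaSeq (1 - x) N`, up to a vanishing error. -/
lemma deriv_hurwitzZetaOdd_zero {x : ℝ} (hx : x ∈ Ioo (0 : ℝ) 1) :
    deriv (hurwitzZetaOdd x) 0 =
      ((1 / 2 * Real.log (Real.Gamma x / Real.Gamma (1 - x)) : ℝ) : ℂ) := by
  set G : ℂ → ℂ := fun s => ∑' m, hurwitzOddTerm x m s with hG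
  have hGd : DifferentiableAt ℂ G 0 :=
    (differentiableOn_tsum_of_summable_norm summable_hurwitzOddTerm_bound
      (fun m s _ => (hasDerivAt_hurwitzOddTerm hx m s).differentiableAt.differentiableWithinAt)
      isOpen_hurwitzOddRegion (fun m s hs => norm_hurwitzOddTerm_le_of_mem hx m hs)).differentiableAt
      (isOpen_hurwitzOddRegion.mem_nhds zero_mem_hurwitzOddRegion)
  have hsum : HasSum (fun m => deriv (hurwitzOddTerm x m) 0) (deriv G 0) :=
    hasSum_deriv_of_summable_norm summable_hurwitzOddTerm_bound
      (fun m s _ => (hasDerivAt_hurwitzOddTerm hx m s).differentiableAt.differentiableWithinAt)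
      isOpen_hurwitzOddRegion (fun m s hs => norm_hurwitzOddTerm_le_of_mem hx m hs)
      zero_mem_hurwitzOddRegion
  have hz : HasDerivAt (fun s => 2 * hurwitzZetaOdd x s)
      (-(Real.log x : ℂ) + Real.log (1 - x) + deriv G 0) 0 := by
    have h1 := (((hasDerivAt_ofReal_cpow_neg hx.1 0).sub
      (hasDerivAt_ofReal_cpow_neg (sub_pos.mpr hx.2) 0)).add hGd.hasDerivAt).sub_const
        (2 * (x : ℂ) - 1)
    have h2 := h1.congr_of_eventuallyEq (f₁ := fun s => 2 * hurwitzZetaOdd x s) (by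
      filter_upwards [isOpen_hurwitzOddRegion.mem_nhds zero_mem_hurwitzOddRegion] with s hs
      exact two_mul_hurwitzZetaOdd_eq hx hs)
    refine h2.congr_deriv ?_
    simp
  have hz' := hz.unique ((differentiable_hurwitzZetaOdd x 0).hasDerivAt.const_mul 2)
  have hlim : Tendsto (fun N : ℕ => (((2 * x - 1) * Real.log (N + 1)
      + ∑ j ∈ Finset.range (N + 1), (Real.log (1 - x + j) - Real.log (x + j)) : ℝ) : ℂ)) atTop
      (𝓝 (-(Real.log x : ℂ) + Real.log (1 - x) + deriv G 0)) := by
    refine (hsum.tendsto_sum_nat.const_add _).congr fun N => ?_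
    rw [← sum_range_log_sub_log]
    push_cast
    congr 1
    refine Finset.sum_congr rfl fun m _ => ?_
    rw [(hasDerivAt_hurwitzOddTerm hx m 0).deriv]
    simp
    ring
  have hΓ : Tendsto (fun N : ℕ => (2 * x - 1) * Real.log (N + 1)
      + ∑ j ∈ Finset.range (N + 1), (Real.log (1 - x + j) - Real.log (x + j))) atTop
      (𝓝 (Real.log (Real.Gamma x / Real.Gamma (1 - x)))) := by
    have h0 := Real.Gamma_pos_of_pos hx.1
    have h1 := Real.Gamma_pos_of_pos (sub_pos.mpr hx.2)
    -- The partial sums carry `log (N + 1)` where `GammaSeq` has `log N`; the discrepancy tends to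
    -- `0`.
    have h2 := (((Real.GammaSeq_tendsto_Gamma x).div (Real.GammaSeq_tendsto_Gamma (1 - x))
      h1.ne').log (div_pos h0 h1).ne').add
      ((Real.tendsto_log_nat_add_one_sub_log).const_mul (2 * x - 1))
    rw [mul_zero, add_zero] at h2
    refine h2.congr' ?_
    filter_upwards [eventually_gt_atTop 0] with N hN
    rw [Pi.div_apply, log_GammaSeq_div hx hN]
    ring
  have := tendsto_nhds_unique hlim ((continuous_ofReal.tendsto _).comp hΓ)
  rw [hz'] at this
  push_cast
  linear_combination this / 2

/-! ### The kernel and its Mellin transform -/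

lemma hasSum_sin_mul_pow (θ : ℝ) {r : ℝ} (hr : |r| < 1) :
    HasSum (fun n : ℕ => Real.sin (n * θ) * r ^ n)
      (r * Real.sin θ / (1 - 2 * r * Real.cos θ + r ^ 2)) := by
  have hz : ‖(r : ℂ) * exp (θ * I)‖ < 1 := by simpa [norm_exp_ofReal_mul_I] using hr
  have h := (hasSum_geometric_of_norm_lt_one hz).mapL imCLM
  convert! h using 1
  · ext n
    have : ((r : ℂ) * exp (θ * I)) ^ n = ((r ^ n : ℝ) : ℂ) * exp ((n * θ : ℝ) * I) := by
      rw [mul_pow, ← exp_nat_mul]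
      push_cast
      ring_nf
    simp only [this, imCLM_apply, im_ofReal_mul, exp_ofReal_mul_I_im]
    ring
  · simp only [imCLM_apply, inv_im, normSq_apply, sub_re, sub_im, one_re, one_im, re_ofReal_mul,
      im_ofReal_mul, exp_ofReal_mul_I_re, exp_ofReal_mul_I_im]
    rw [show (1 - r * Real.cos θ) * (1 - r * Real.cos θ) + (0 - r * Real.sin θ) *
      (0 - r * Real.sin θ) = 1 - 2 * r * Real.cos θ + r ^ 2 by
        linear_combination r ^ 2 * Real.sin_sq_add_cos_sq θ]
    ring

lemma neg_one_lt_cos_of_mem_Ioo {a : ℝ} (ha : a ∈ Ioo (-Real.pi) Real.pi) : -1 < Real.cos a := by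
  rw [← Real.cos_abs, ← Real.cos_pi]
  exact Real.cos_lt_cos_of_nonneg_of_le_pi (abs_nonneg a) le_rfl (abs_lt.mpr ha)

lemma one_add_two_mul_cos_add_sq_pos {a : ℝ} (ha : a ∈ Ioo (-Real.pi) Real.pi) {y : ℝ}
    (hy : 0 ≤ y) : 0 < 1 + 2 * y * Real.cos a + y ^ 2 := by
  have h := neg_one_lt_cos_of_mem_Ioo ha
  rcases hy.eq_or_lt with rfl | hy
  · norm_num
  -- The denominator is `(1 - y)² + 2y(1 + cos a)`.
  · nlinarith [sq_nonneg (1 - y), mul_pos hy (by linarith : 0 < 1 + Real.cos a)]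

/-- The Poisson-type kernel `∑ (-1) ^ (n - 1) sin (n a) exp (-n t)`. -/
noncomputable def malmstenKernel (a t : ℝ) : ℝ :=
  Real.exp (-t) * (Real.sin a / (1 + 2 * Real.exp (-t) * Real.cos a + Real.exp (-t) ^ 2))

lemma continuous_malmstenKernel {a : ℝ} (ha : a ∈ Ioo (-Real.pi) Real.pi) :
    Continuous (malmstenKernel a) := by
  unfold malmstenKernel
  refine Continuous.mul (by fun_prop) (continuous_const.div (by fun_prop) fun t => ?_)
  exact (one_add_two_mul_cos_add_sq_pos ha (Real.exp_pos _).le).ne'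

lemma malmstenKernel_isBigO_atTop (a b : ℝ) :
    (fun t => (malmstenKernel a t : ℂ)) =O[atTop] (fun t : ℝ => t ^ (-b)) := by
  have h1 : Tendsto (fun t : ℝ => Real.exp (-t)) atTop (𝓝 0) := Real.tendsto_exp_neg_atTop_nhds_zero
  have h2 : Tendsto (fun t : ℝ => Real.sin a /
      (1 + 2 * Real.exp (-t) * Real.cos a + Real.exp (-t) ^ 2)) atTop (𝓝 (Real.sin a / 1)) := by
    refine tendsto_const_nhds.div ?_ one_ne_zero
    have := (((h1.const_mul 2).mul_const (Real.cos a)).const_add 1).add (h1.pow 2)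
    simpa using this
  have h3 := (Asymptotics.isBigO_refl (fun t : ℝ => Real.exp (-t)) atTop).mul (h2.isBigO_one ℝ)
  simp only [mul_one] at h3
  have h4 := h3.trans (by simpa using (isLittleO_exp_neg_mul_rpow_atTop one_pos (-b)).isBigO)
  exact isBigO_ofReal_left.mpr h4

lemma malmstenKernel_isBigO_zero {a : ℝ} (ha : a ∈ Ioo (-Real.pi) Real.pi) :
    (fun t => (malmstenKernel a t : ℂ)) =O[𝓝[>] 0] (fun t : ℝ => t ^ (-0 : ℝ)) := by
  simp only [neg_zero, Real.rpow_zero]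
  exact (((continuous_ofReal.comp (continuous_malmstenKernel ha)).tendsto 0).isBigO_one ℝ).mono
    nhdsWithin_le_nhds

lemma hasDerivAt_mellin_malmstenKernel {a : ℝ} (ha : a ∈ Ioo (-Real.pi) Real.pi) {s : ℂ}
    (hs : 0 < s.re) :
    MellinConvergent (fun t => Real.log t • (malmstenKernel a t : ℂ)) s ∧
      HasDerivAt (mellin fun t => (malmstenKernel a t : ℂ))
        (mellin (fun t => Real.log t • (malmstenKernel a t : ℂ)) s) s :=
  mellin_hasDerivAt_of_isBigO_rpow
    ((continuous_ofReal.comp (continuous_malmstenKernel ha)).locallyIntegrable.locallyIntegrableOn _)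
    (malmstenKernel_isBigO_atTop a (s.re + 1)) (lt_add_one _) (malmstenKernel_isBigO_zero ha) hs

lemma mellin_malmstenKernel_of_one_lt_re (a : ℝ) {s : ℂ}
    (hs : 1 < s.re) : mellin (fun t => (malmstenKernel a t : ℂ)) s =
      -(Gamma s * sinZeta ((1 / 2 + a / (2 * Real.pi) : ℝ) : UnitAddCircle) s) := by
  set x : ℝ := 1 / 2 + a / (2 * Real.pi) with hx
  -- The shift by `π` produces the alternating signs of the sine expansion of the kernel.
  have hθ : 2 * Real.pi * x = a + Real.pi := by
    rw [hx]; field_simp; ring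
  have h1 := hasSum_mellin (a := fun n : ℕ => ((-Real.sin (2 * Real.pi * x * n) : ℝ) : ℂ))
    (p := fun n : ℕ => (n : ℝ)) (F := fun t => (malmstenKernel a t : ℂ)) (s := s) ?_ (by linarith) ?_ ?_
  · have h2 := ((hasSum_nat_sinZeta x hs).mul_left (Gamma s)).neg
    refine h1.unique (h2.congr_fun fun n => ?_)
    push_cast
    ring
  · intro n
    rcases n.eq_zero_or_pos with rfl | hn
    · simp
    · exact Or.inr (Nat.cast_pos.mpr hn)
  · intro t ht
    have hr : |Real.exp (-t)| < 1 := by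
      rw [abs_of_pos (Real.exp_pos _)]; exact Real.exp_lt_one_iff.mpr (neg_neg_of_pos ht)
    have h2 := (hasSum_sin_mul_pow (2 * Real.pi * x) hr).neg
    have h3 := h2.mapL ofRealCLM
    convert! h3 using 1
    · ext n
      simp only [ofRealCLM_apply]
      rw [← ofReal_mul, ← Real.exp_nat_mul]
      ring_nf
    · simp only [ofRealCLM_apply, malmstenKernel, hθ, Real.sin_add_pi, Real.cos_add_pi]
      ring_nf
  · refine Summable.of_nonneg_of_le (fun n => by positivity) (fun n => ?_)
      (Real.summable_one_div_nat_rpow.mpr hs)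
    have : ‖((-Real.sin (2 * Real.pi * x * n) : ℝ) : ℂ)‖ ≤ 1 := by
      rw [norm_real, norm_neg]; exact Real.abs_sin_le_one _
    gcongr

/-- The point `s = 1` lies on the edge of the half-plane of absolute convergence, so the formula is
continued analytically to `0 < re s`. -/
lemma mellin_malmstenKernel {a : ℝ} (ha : a ∈ Ioo (-Real.pi) Real.pi) {s : ℂ}
    (hs : 0 < s.re) : mellin (fun t => (malmstenKernel a t : ℂ)) s =
      -(Gamma s * sinZeta ((1 / 2 + a / (2 * Real.pi) : ℝ) : UnitAddCircle) s) := by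
  have ho : IsOpen {s : ℂ | 0 < s.re} := isOpen_lt continuous_const continuous_re
  have hf : AnalyticOnNhd ℂ (mellin fun t => (malmstenKernel a t : ℂ)) {s : ℂ | 0 < s.re} :=
    DifferentiableOn.analyticOnNhd (fun s hs =>
      (hasDerivAt_mellin_malmstenKernel ha hs).2.differentiableAt.differentiableWithinAt) ho
  have hg : AnalyticOnNhd ℂ (fun s => -(Gamma s *
      sinZeta ((1 / 2 + a / (2 * Real.pi) : ℝ) : UnitAddCircle) s)) {s : ℂ | 0 < s.re} := by
    refine DifferentiableOn.analyticOnNhd (fun s hs => ?_) ho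
    refine (DifferentiableAt.mul (differentiableAt_Gamma s fun m h => ?_)
      (differentiableAt_sinZeta _ s)).neg.differentiableWithinAt
    have h0 : 0 < s.re := hs
    rw [h] at h0
    simp at h0
    linarith [m.cast_nonneg (α := ℝ)]
  refine hf.eqOn_of_preconnected_of_eventuallyEq hg (convex_halfSpace_re_gt 0).isPreconnected
    (z₀ := 2) (by simp) ?_ hs
  filter_upwards [(isOpen_lt continuous_const continuous_re).mem_nhds
    (show (1 : ℝ) < (2 : ℂ).re by simp)] with w hw
  exact mellin_malmstenKernel_of_one_lt_re a hw

lemma hurwitzZetaOdd_one_sub_eq_mellin {a : ℝ} (ha : a ∈ Ioo (-Real.pi) Real.pi) {s : ℂ}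
    (hs : 0 < s.re) :
    hurwitzZetaOdd ((1 / 2 + a / (2 * Real.pi) : ℝ) : UnitAddCircle) (1 - s) =
      -(2 * (2 * Real.pi : ℂ) ^ (-s) * sin (Real.pi * s / 2)
        * mellin (fun t => (malmstenKernel a t : ℂ)) s) := by
  rw [mellin_malmstenKernel ha hs, hurwitzZetaOdd_one_sub]
  · ring
  · rintro n rfl
    simp at hs
    linarith [n.cast_nonneg (α := ℝ)]

lemma half_add_div_two_pi_mem_Ioo {a : ℝ} (ha : a ∈ Ioo (-Real.pi) Real.pi) :
    1 / 2 + a / (2 * Real.pi) ∈ Ioo (0 : ℝ) 1 := by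
  have h := Real.pi_pos
  have h1 : -(1 / 2) < a / (2 * Real.pi) := by rw [lt_div_iff₀ (by positivity)]; linarith [ha.1]
  have h2 : a / (2 * Real.pi) < 1 / 2 := by rw [div_lt_iff₀ (by positivity)]; linarith [ha.2]
  constructor <;> linarith

/-- Differentiate the functional equation at `s = 1`. The sine factor is stationary there; the
factor `(2π)^(-s)` and `M 1 = a / 2` account for the `log (2π)` term. -/
lemma mellin_log_mul_malmstenKernel_one {a : ℝ} (ha : a ∈ Ioo (-Real.pi) Real.pi) :
    mellin (fun t => Real.log t • (malmstenKernel a t : ℂ)) 1 =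
      ((Real.pi / 2 * Real.log (Real.Gamma (1 / 2 + a / (2 * Real.pi)) /
        Real.Gamma (1 / 2 - a / (2 * Real.pi))) + a / 2 * Real.log (2 * Real.pi) : ℝ) : ℂ) := by
  set x : ℝ := 1 / 2 + a / (2 * Real.pi) with hx
  have hx' : x ∈ Ioo (0 : ℝ) 1 := half_add_div_two_pi_mem_Ioo ha
  have hπ : (Real.pi : ℂ) ≠ 0 := ofReal_ne_zero.mpr Real.pi_ne_zero
  have hM := (hasDerivAt_mellin_malmstenKernel ha (s := 1) (by simp)).2
  set M := mellin fun t => (malmstenKernel a t : ℂ)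
  set M' := mellin (fun t => Real.log t • (malmstenKernel a t : ℂ)) 1
  have hval : M 1 = a / 2 := by
    have h := hurwitzZetaOdd_one_sub_eq_mellin ha (s := 1) (by simp)
    rw [sub_self, hurwitzZetaOdd_zero_of_mem_Ioo hx', mul_one, sin_pi_div_two, cpow_neg_one] at h
    change _ = -(_ * M 1) at h
    simp only [hx] at h
    push_cast at h
    field_simp at h
    linear_combination h / 2
  have h1 : HasDerivAt (fun s : ℂ => hurwitzZetaOdd x (1 - s))
      (deriv (hurwitzZetaOdd x) 0 * (-1)) 1 := by
    have h := (differentiable_hurwitzZetaOdd x (1 - 1)).hasDerivAt.comp (1 : ℂ)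
      ((hasDerivAt_id (1 : ℂ)).const_sub 1)
    simpa [Function.comp_def] using h
  have hsin : HasDerivAt (fun s : ℂ => sin (Real.pi * s / 2)) 0 1 := by
    have h := (((hasDerivAt_id (1 : ℂ)).const_mul (Real.pi : ℂ)).div_const 2).csin
    simpa using h
  have hpow := hasDerivAt_ofReal_cpow_neg Real.two_pi_pos 1
  have h2 := (((hpow.const_mul 2).mul hsin).mul hM).neg
  have h3 := h1.congr_of_eventuallyEq (f₁ := fun s : ℂ =>
      -(2 * ((2 * Real.pi : ℝ) : ℂ) ^ (-s) * sin (Real.pi * s / 2) * M s)) (by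
    filter_upwards [(isOpen_lt continuous_const continuous_re).mem_nhds
      (show (0 : ℝ) < (1 : ℂ).re by simp)] with s hs
    rw [hurwitzZetaOdd_one_sub_eq_mellin ha hs]
    push_cast
    rfl)
  have h4 := h3.unique h2
  rw [deriv_hurwitzZetaOdd_zero hx', Pi.mul_apply, hval, mul_one, sin_pi_div_two,
    cpow_neg_one, show 1 - x = 1 / 2 - a / (2 * Real.pi) by rw [hx]; ring] at h4
  generalize Real.log (Real.Gamma x / _) = l at h4 ⊢
  push_cast at h4 ⊢
  field_simp at h4
  linear_combination h4 / 2

/-! ### Change of variables `y = exp (-t)` -/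

lemma image_exp_neg_Ioi_zero : (fun t : ℝ => Real.exp (-t)) '' Ioi 0 = Ioo 0 1 := by
  ext y
  constructor
  · rintro ⟨t, ht, rfl⟩
    exact ⟨Real.exp_pos _, Real.exp_lt_one_iff.mpr (neg_neg_of_pos ht)⟩
  · rintro ⟨h0, h1⟩
    exact ⟨-Real.log y, neg_pos.mpr (Real.log_neg h0 h1), by simp [Real.exp_log h0]⟩

lemma integrableOn_log_mul_malmstenKernel {a : ℝ} (ha : a ∈ Ioo (-Real.pi) Real.pi) :
    IntegrableOn (fun t => Real.log t * malmstenKernel a t) (Ioi 0) := by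
  have h := (hasDerivAt_mellin_malmstenKernel ha (s := 1) (by simp)).1
  refine (Integrable.re h).congr (Eventually.of_forall fun t => ?_)
  simp

lemma integral_log_mul_malmstenKernel {a : ℝ} (ha : a ∈ Ioo (-Real.pi) Real.pi) :
    ∫ t in Ioi 0, Real.log t * malmstenKernel a t =
      Real.pi / 2 * Real.log (Real.Gamma (1 / 2 + a / (2 * Real.pi)) /
        Real.Gamma (1 / 2 - a / (2 * Real.pi))) + a / 2 * Real.log (2 * Real.pi) := by
  rw [← ofReal_inj, ← mellin_log_mul_malmstenKernel_one ha, ← integral_complex_ofReal, mellin]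
  simp

theorem mainTheorem1 (a : ℝ) (ha₀ : -Real.pi < a) (ha₁ : a < Real.pi) :
    IntervalIntegrable
      (fun y : ℝ => Real.log (Real.log (1 / y)) * Real.sin a / (1 + 2 * y * Real.cos a + y ^ 2))
      MeasureTheory.volume 0 1 ∧
    ∫ y in (0 : ℝ)..1,
        Real.log (Real.log (1 / y)) * Real.sin a / (1 + 2 * y * Real.cos a + y ^ 2) =
      Real.pi / 2 *
        Real.log ((2 * Real.pi) ^ (a / Real.pi) * Real.Gamma (1 / 2 + a / (2 * Real.pi)) /
          Real.Gamma (1 / 2 - a / (2 * Real.pi))) := by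
  have ha : a ∈ Ioo (-Real.pi) Real.pi := ⟨ha₀, ha₁⟩
  have hd : ∀ t ∈ Ioi (0 : ℝ),
      HasDerivWithinAt (fun t : ℝ => Real.exp (-t)) (-Real.exp (-t)) (Ioi 0) t := fun t _ => by
    simpa using (hasDerivAt_neg t).exp.hasDerivWithinAt
  have hinj : InjOn (fun t : ℝ => Real.exp (-t)) (Ioi 0) :=
    (Real.exp_injective.comp neg_injective).injOn
  -- The Jacobian `exp (-t)` is the leading factor in `malmstenKernel`.
  have hsubst (t : ℝ) : |-Real.exp (-t)| • (Real.log (Real.log (1 / Real.exp (-t))) * Real.sin a /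
      (1 + 2 * Real.exp (-t) * Real.cos a + Real.exp (-t) ^ 2)) =
      Real.log t * malmstenKernel a t := by
    rw [abs_neg, abs_of_pos (Real.exp_pos _), one_div, ← Real.exp_neg, neg_neg, Real.log_exp,
      malmstenKernel, smul_eq_mul]
    ring
  constructor
  · rw [intervalIntegrable_iff_integrableOn_Ioo_of_le zero_le_one, ← image_exp_neg_Ioi_zero,
      integrableOn_image_iff_integrableOn_abs_deriv_smul measurableSet_Ioi hd hinj]
    simpa only [hsubst] using integrableOn_log_mul_malmstenKernel ha
  · rw [intervalIntegral.integral_of_le zero_le_one, integral_Ioc_eq_integral_Ioo,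
      ← image_exp_neg_Ioi_zero,
      integral_image_eq_integral_abs_deriv_smul measurableSet_Ioi hd hinj]
    simp only [hsubst]
    obtain ⟨h0, h1⟩ := half_add_div_two_pi_mem_Ioo ha
    have hΓ : Real.Gamma (1 / 2 + a / (2 * Real.pi)) /
        Real.Gamma (1 / 2 - a / (2 * Real.pi)) ≠ 0 :=
      (div_pos (Real.Gamma_pos_of_pos h0) (Real.Gamma_pos_of_pos (by linarith))).ne'
    rw [integral_log_mul_malmstenKernel ha, mul_div_assoc,
      Real.log_mul (Real.rpow_pos_of_pos Real.two_pi_pos _).ne' hΓ, Real.log_rpow Real.two_pi_pos]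
    field_simp
    ring
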